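/- Let $n\ge 0$, let $A\in\mathbb{C}^{n\times n}$, put $\Re(A)=\tfrac12(A+A^*)$ and $\Im(A)=\tfrac1{2i}(A-A^*)$, and let $$f_A=\det\bigl(tI_n+x\,\Re(A)+y\,\Im(A)\bigr)\in\mathbb{R}[t,x,y].$$ Let $f=f_A^{\rm red}$ be the square-free part of $f_A$ (the product of its distinct irreducible factors, up to scaling). Let $\mathcal{V}(f_A)\subset\mathbb{P}^2(\mathbb{C})$ be the zero set of $f_A$, let $\mathrm{Sing}(f_A)$ be the set of points of $\mathcal{V}(f_A)$ at which $\nabla f$ vanishes, and let the dual curve $\mathcal{V}(f_A)^*\subset\mathbb{P}^2(\mathbb{C})$ be the image of $\mathcal{V}(f_A)\setminus\mathrm{Sing}(f_A)$ under $p\mapsto[\nabla f(p)]$. Let $I\subset\mathbb{R}[t,x,y,a,b]$ be the ideal generated by $f$, by $t+ax+by$, and by the $2\times2$ minors of $$\begin{pmatrix}1&a&b\\ \frac{\partial f}{\partial t}&\frac{\partial f}{\partial x}&\frac{\partial f}{\partial y}\end{pmatrix},$$ and let $$J=\sqrt{\bigl(I:\langle t,x,y\rangle^\infty\bigr)\cap\mathbb{R}[a,b]}\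 \subset\ \mathbb{R}[a,b].$$ Suppose that $f_A$ is not of the form $\ell^m$ with $\ell\in\mathbb{R}[t,x,y]$ a linear form and $m\ge0$. Then the ideal $J$ is principal, and its variety $\mathcal{V}(J)\subset\mathbb{C}^2$ is $$\mathcal{V}(J)=\{(a,b)\in\mathbb{C}^2:[1:a:b]\in\mathcal{V}(f_A)^*\}\ \cup\bigcup_{[p_0:p_1:p_2]\in\mathrm{Sing}(f_A)}\{(a,b)\in\mathbb{C}^2:p_0+p_1a+p_2b=0\}.$$ -/

import Mathlib

open MvPolynomial

noncomputable section

namespace Kippenhahn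

/-- Real (Hermitian) part `(A + A*) / 2` of a complex matrix. -/
def rePart {n : ℕ} (A : Matrix (Fin n) (Fin n) ℂ) : Matrix (Fin n) (Fin n) ℂ :=
  (1 / 2 : ℂ) • (A + A.conjTranspose)

/-- Imaginary (Hermitian) part `(A - A*) / (2i)` of a complex matrix. -/
def imPart {n : ℕ} (A : Matrix (Fin n) (Fin n) ℂ) : Matrix (Fin n) (Fin n) ℂ :=
  (1 / (2 * Complex.I) : ℂ) • (A - A.conjTranspose)

/-- The linear matrix pencil `t I + x Re(A) + y Im(A)` over `ℂ[t, x, y]`, where the variables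
`t, x, y` are `X 0, X 1, X 2`. -/
def pencil {n : ℕ} (A : Matrix (Fin n) (Fin n) ℂ) :
    Matrix (Fin n) (Fin n) (MvPolynomial (Fin 3) ℂ) :=
  (X 0 : MvPolynomial (Fin 3) ℂ) • (1 : Matrix (Fin n) (Fin n) (MvPolynomial (Fin 3) ℂ))
    + (X 1 : MvPolynomial (Fin 3) ℂ) • (rePart A).map C
    + (X 2 : MvPolynomial (Fin 3) ℂ) • (imPart A).map C

/-- The Kippenhahn polynomial `f_A = det (t I + x Re(A) + y Im(A))` as an element of
`ℝ[t, x, y]`. The determinant has real coefficients, see `map_kippenhahnPoly`. -/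
def kippenhahnPoly {n : ℕ} (A : Matrix (Fin n) (Fin n) ℂ) : MvPolynomial (Fin 3) ℝ :=
  ∑ m ∈ (pencil A).det.support, monomial m ((pencil A).det.coeff m).re

theorem conj_rePart {n : ℕ} (A : Matrix (Fin n) (Fin n) ℂ) (i j : Fin n) :
    (starRingEnd ℂ) (rePart A i j) = rePart A j i := by
  simp [rePart, Matrix.conjTranspose_apply, add_comm, Complex.conj_ofNat]

theorem conj_imPart {n : ℕ} (A : Matrix (Fin n) (Fin n) ℂ) (i j : Fin n) :
    (starRingEnd ℂ) (imPart A i j) = imPart A j i := by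
  simp [imPart, Matrix.conjTranspose_apply, Complex.conj_ofNat]
  ring

theorem map_conj_det_pencil {n : ℕ} (A : Matrix (Fin n) (Fin n) ℂ) :
    map (starRingEnd ℂ) (pencil A).det = (pencil A).det := by
  rw [RingHom.map_det, ← Matrix.det_transpose (pencil A)]
  congr 1
  ext1 i j
  simp only [RingHom.mapMatrix_apply, Matrix.map_apply, pencil, Matrix.add_apply,
    Matrix.smul_apply, Matrix.transpose_apply, smul_eq_mul, map_add, map_mul, map_X, map_C,
    conj_rePart, conj_imPart, Matrix.one_apply]
  by_cases h : i = j
  · simp [h]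
  · simp [h, Ne.symm h]

/-- Over `ℂ`, the real polynomial `f_A` is the determinant of the pencil. -/
theorem map_kippenhahnPoly {n : ℕ} (A : Matrix (Fin n) (Fin n) ℂ) :
    map (algebraMap ℝ ℂ) (kippenhahnPoly A) = (pencil A).det := by
  have h : ∀ m, (((pencil A).det.coeff m).re : ℂ) = (pencil A).det.coeff m := fun m => by
    rw [← Complex.conj_eq_iff_re, ← coeff_map, map_conj_det_pencil]
  conv_rhs => rw [(pencil A).det.as_sum]
  simp only [kippenhahnPoly, map_sum, map_monomial, Complex.coe_algebraMap, h]

/-- `f` is a power `ℓ ^ m` of a linear form `ℓ = c₀ t + c₁ x + c₂ y` with real coefficients. -/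
def IsPowerOfLinearForm (f : MvPolynomial (Fin 3) ℝ) : Prop :=
  ∃ (ℓ : MvPolynomial (Fin 3) ℝ) (m : ℕ), ℓ.IsHomogeneous 1 ∧ f = ℓ ^ m

/-- The square-free part `f^red` of `f`: the product of the distinct irreducible factors of `f`,
each factor being taken up to a nonzero scalar. -/
def red (f : MvPolynomial (Fin 3) ℝ) : MvPolynomial (Fin 3) ℝ :=
  letI : StrongNormalizationMonoid (MvPolynomial (Fin 3) ℝ) :=
    UniqueFactorizationMonoid.strongNormalizationMonoid
  UniqueFactorizationMonoid.radical f

/-- The complex projective plane `ℙ²(ℂ)`. -/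
abbrev P2 : Type := Projectivization ℂ (Fin 3 → ℂ)

/-- The gradient of `f` at the complex point `v`. -/
def grad (f : MvPolynomial (Fin 3) ℝ) (v : Fin 3 → ℂ) : Fin 3 → ℂ :=
  fun i => aeval v (pderiv i f)

/-- The zero set in `ℙ²(ℂ)` of a homogeneous polynomial `f`. -/
def projVariety (f : MvPolynomial (Fin 3) ℝ) : Set P2 :=
  {p | aeval p.rep f = 0}

/-- The singular points of `V(f)`: the points of `V(f)` where the gradient of `f^red` is zero. -/
def Sing (f : MvPolynomial (Fin 3) ℝ) : Set P2 :=
  {p | p ∈ projVariety f ∧ grad (red f) p.rep = 0}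

/-- The dual variety `V(f)^*`: the image of `V(f) \ Sing(f)` under the map
`p ↦ [∇ f^red (p)]`. -/
def dualVariety (f : MvPolynomial (Fin 3) ℝ) : Set P2 :=
  {q | ∃ p : P2, p ∈ projVariety f \ Sing f ∧
    ∃ h : grad (red f) p.rep ≠ 0, q = Projectivization.mk ℂ (grad (red f) p.rep) h}

/-- The point `[1 : a : b]` of `ℙ²(ℂ)` attached to the point `(a, b)` of `ℂ²`. -/
def affinePoint (z : Fin 2 → ℂ) : P2 :=
  Projectivization.mk ℂ ![1, z 0, z 1] (fun h => one_ne_zero (congrFun h 0))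

/-- The zero set of `p₀ + p₁ a + p₂ b` in `ℂ²`, for `p = [p₀ : p₁ : p₂]`. -/
def dualLine (p : P2) : Set (Fin 2 → ℂ) :=
  {z | p.rep 0 + p.rep 1 * z 0 + p.rep 2 * z 1 = 0}

/-- The ring `ℝ[t, x, y, a, b]`; `t, x, y` are indexed by `Sum.inl 0, Sum.inl 1, Sum.inl 2` and
`a, b` by `Sum.inr 0, Sum.inr 1`. -/
abbrev R5 : Type := MvPolynomial (Fin 3 ⊕ Fin 2) ℝ

/-- The matrix with rows `(1, a, b)` and `(∂f/∂t, ∂f/∂x, ∂f/∂y)`. -/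
def polarMatrix (f : MvPolynomial (Fin 3) ℝ) : Matrix (Fin 2) (Fin 3) R5 :=
  ![![1, X (Sum.inr 0), X (Sum.inr 1)], fun i => rename Sum.inl (pderiv i f)]

/-- The ideal of `ℝ[t, x, y, a, b]` generated by `f`, by `t + a x + b y`, and by the `2 × 2` minors
of `polarMatrix f`. -/
def incidenceIdeal (f : MvPolynomial (Fin 3) ℝ) : Ideal R5 :=
  Ideal.span {rename Sum.inl f,
      X (Sum.inl 0) + X (Sum.inr 0) * X (Sum.inl 1) + X (Sum.inr 1) * X (Sum.inl 2)}
    ⊔ Ideal.span (Set.range fun ij : Fin 3 × Fin 3 =>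
        ((polarMatrix f).submatrix id ![ij.1, ij.2]).det)

/-- The irrelevant ideal `⟨t, x, y⟩`. -/
def irrelevantIdeal : Ideal R5 :=
  Ideal.span (Set.range fun i : Fin 3 => (X (Sum.inl i) : R5))

/-- The saturation `I : K^∞ = ⋃ₙ (I : Kⁿ)`; the union is increasing, hence it is the supremum. -/
def saturate {R : Type*} [CommRing R] (I K : Ideal R) : Ideal R :=
  ⨆ n : ℕ, Submodule.colon I ((K ^ n : Ideal R) : Set R)

/-- Elimination of `t, x, y`: the intersection of an ideal of `ℝ[t, x, y, a, b]` with
`ℝ[a, b]`. -/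
def eliminate (I : Ideal R5) : Ideal (MvPolynomial (Fin 2) ℝ) :=
  I.comap (rename Sum.inr : MvPolynomial (Fin 2) ℝ →ₐ[ℝ] R5)

/-- The ideal `J = radical (eliminate (I : ⟨t, x, y⟩^∞, {t, x, y}))` of `ℝ[a, b]` attached to `A`,
where `I` is the incidence ideal of `f_A^red`. -/
def idealJ {n : ℕ} (A : Matrix (Fin n) (Fin n) ℂ) : Ideal (MvPolynomial (Fin 2) ℝ) :=
  (eliminate (saturate (incidenceIdeal (red (kippenhahnPoly A))) irrelevantIdeal)).radical

end Kippenhahn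

end

/-! Write F for f over ℂ. Both claims pass through `dualSet F`: the points (a,b) over which some
nonzero p satisfies F(p) = 0, lies on the line t + ax + by = 0 and has gradient proportional to
(1,a,b), possibly zero.

The projection from the projective plane is closed: if no such p exists over z, elimination theory
produces an element of the eliminated ideal that is nonzero at z (`exists_C_mul_monomial_mem_span`).
Hence V(J) is exactly `dualSet F` (`zeroLocus_radical_eliminate`). Splitting by whether the gradient
at p vanishes turns `dualSet F` into the dual curve together with the lines dual to singular points
(`dualVariety_union_dualLines`).

A radical ideal in two variables is principal once its variety has no isolated points; the test used
is that a polynomial nonzero at only finitely many points of the variety vanishes on all of it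
(`isPrincipal_of_isRadical`). Dual lines pass this test because they are infinite. A regular point
could fail it only if the Gauss map is constant on a component of the curve. Such a component is a
line, and since deg F ≥ 2 it contains a singular point of the curve, whose dual line passes through
the point in question (`exists_singular_of_regular`). Excluding powers of a linear form is what
gives deg F ≥ 2. -/

/-! ### Elimination theory for homogeneous systems -/

/-- By the Nullstellensatz the specialised forms generate every monomial of some degree m. So
finitely many degree-m elements of the ideal over R have a square coefficient matrix whose
determinant survives φ; that determinant is h, and Cramer's rule gives the memberships. -/
theorem MvPolynomial.exists_C_mul_monomial_mem_span {R K σ ι : Type*} [CommRing R] [Field K]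
    [IsAlgClosed K] [Finite σ] (φ : R →+* K) (g : ι → MvPolynomial σ R) (d : ι → ℕ)
    (hg : ∀ i, (g i).IsHomogeneous (d i))
    (h0 : ∀ p : σ → K, (∀ i, eval₂ φ p (g i) = 0) → p = 0) :
    ∃ (h : R) (m : ℕ), φ h ≠ 0 ∧
      ∀ s : σ →₀ ℕ, s.degree = m → C h * monomial s 1 ∈ Ideal.span (Set.range g) := by
  classical
  set IK : Ideal (MvPolynomial σ K) := Ideal.span (Set.range fun i => map φ (g i)) with hIK
  obtain ⟨m, hm⟩ : ∃ m, idealOfVars σ K ^ m ≤ IK := by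
    apply Ideal.exists_pow_le_of_le_radical_of_fg _ (idealOfVars_fg σ K)
    rw [← vanishingIdeal_zeroLocus_eq_radical (K := K), Ideal.span_le]
    rintro _ ⟨i, rfl⟩
    rw [SetLike.mem_coe, mem_vanishingIdeal_iff]
    intro p hp
    rw [zeroLocus_span] at hp
    have : p = 0 := h0 p fun i => by
      have := hp _ ⟨i, rfl⟩
      simpa [aeval_def, eval₂_map] using this
    simp [this]
  let D := {s : σ →₀ ℕ // s.degree = m}
  have : Finite D := Set.Finite.subset (Finsupp.finite_of_degree_le m) (fun s hs => le_of_eq hs)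
  have := Fintype.ofFinite D
  let W : Set (MvPolynomial σ R) := {w | w ∈ Ideal.span (Set.range g) ∧ w.IsHomogeneous m}
  let Φ : MvPolynomial σ R → D → K := fun w s => φ (coeff s.1 w)
  let Ψ : MvPolynomial σ K →ₗ[K] D → K := LinearMap.pi fun s => lcoeff K s.1
  -- The multiplier c is built in because the target is only K-linear, not an ideal. For a monomial
  -- c times a generator, only total degree m contributes.
  have hΨ : ∀ q ∈ IK, ∀ c, Ψ (c * q) ∈ Submodule.span K (Φ '' W) := by
    intro q hq
    induction hq using Submodule.span_induction with
    | mem x hx =>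
      obtain ⟨i, rfl⟩ := hx
      intro c
      induction c using MvPolynomial.induction_on' with
      | monomial u a =>
        by_cases hu : u.degree + d i = m
        · have hw : monomial u 1 * g i ∈ W :=
            ⟨Ideal.mul_mem_left _ _ (Ideal.subset_span ⟨i, rfl⟩),
              hu ▸ (isHomogeneous_monomial _ rfl).mul (hg i)⟩
          have : Ψ (monomial u a * map φ (g i)) = a • Φ (monomial u 1 * g i) := by
            ext s
            simp [Ψ, Φ, coeff_monomial_mul', coeff_map, apply_ite φ]
          rw [this]
          exact Submodule.smul_mem _ _ (Submodule.subset_span ⟨_, hw, rfl⟩)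
        · have : Ψ (monomial u a * map φ (g i)) = 0 := by
            ext s
            have h := ((isHomogeneous_monomial a (rfl : u.degree = u.degree)).mul
              ((hg i).map φ)).coeff_eq_zero (d := s.1) (by rw [s.2]; exact Ne.symm hu)
            simpa [Ψ] using h
          rw [this]
          exact zero_mem _
      | add p q hp hq => rw [add_mul, map_add]; exact add_mem hp hq
    | zero => simp
    | add x y _ _ hx hy => intro c; rw [mul_add, map_add]; exact add_mem (hx c) (hy c)
    | smul a x _ hx => intro c; rw [smul_eq_mul, ← mul_assoc]; exact hx _
  have htop : Submodule.span K (Φ '' W) = ⊤ := by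
    rw [eq_top_iff, ← (Pi.basisFun K D).span_eq, Submodule.span_le]
    rintro _ ⟨s, rfl⟩
    have hs : monomial s.1 (1 : K) ∈ IK :=
      hm ((monomial_mem_pow_idealOfVars_iff m s.1 one_ne_zero).2 s.2.ge)
    have := hΨ _ hs 1
    convert! this
    ext t
    by_cases hst : s = t
    · simp [Ψ, hst]
    · have : s.1 ≠ t.1 := fun h => hst (Subtype.ext h)
      simp [Ψ, coeff_monomial, this, hst]
  obtain ⟨b, hb, hspan, hli⟩ := exists_linearIndependent K (Φ '' W)
  let bas : Module.Basis b K (D → K) := Module.Basis.mk hli (by simp [hspan, htop])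
  let e : D ≃ b := (Pi.basisFun K D).indexEquiv bas
  choose w hwW hw using fun j : D => hb (e j).2
  let B : Matrix D D R := fun j s => coeff s.1 (w j)
  have hB : LinearIndependent K (B.map φ).row := by
    have := hli.comp e e.injective
    convert! this using 1
    ext j s
    simp only [Matrix.row, Function.comp_apply, ← hw, Φ, B]
    rfl
  rw [Matrix.linearIndependent_rows_iff_isUnit, Matrix.isUnit_iff_isUnit_det,
    ← RingHom.mapMatrix_apply, ← RingHom.map_det] at hB
  refine ⟨B.det, m, hB.ne_zero, fun s hs => ?_⟩
  -- Row s of adj(B)·B = det(B)·1, read as an identity of polynomials homogeneous of degree m.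
  have key : C B.det * monomial s 1 = ∑ j, C (B.adjugate ⟨s, hs⟩ j) * w j := by
    ext u
    rw [coeff_C_mul, coeff_sum]
    simp only [coeff_C_mul]
    by_cases hu : u.degree = m
    · have := congrFun (congrFun B.adjugate_mul ⟨s, hs⟩) ⟨u, hu⟩
      rw [Matrix.mul_apply] at this
      simp only [B] at this ⊢
      rw [this]
      simp [coeff_monomial, Matrix.one_apply]
    · rw [coeff_monomial, if_neg (by rintro rfl; exact hu hs), mul_zero]
      exact (Finset.sum_eq_zero fun j _ => by rw [(hwW j).2.coeff_eq_zero hu, mul_zero]).symm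
  rw [key]
  exact Ideal.sum_mem _ fun j _ => Ideal.mul_mem_left _ _ (hwW j).1

/-! ### Principal radical ideals in two variables -/

/-- Otherwise 0 < (π) < P < M, with π a prime element of P, is a chain of length 3. -/
theorem Ideal.IsPrime.isPrincipal_or_isMaximal {R : Type*} [CommRing R] [IsDomain R]
    [UniqueFactorizationMonoid R] (hR : ringKrullDim R ≤ 2) {P : Ideal R} (hP : P.IsPrime) :
    P.IsPrincipal ∨ P.IsMaximal := by
  by_cases hbot : P = ⊥
  · left; rw [hbot]; infer_instance
  obtain ⟨π, hπP, hπ⟩ := hP.exists_mem_prime_of_ne_bot hbot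
  by_cases hPπ : P = Ideal.span {π}
  · left; rw [hPπ]; exact ⟨⟨π, rfl⟩⟩
  right
  by_contra hmax
  obtain ⟨M, hM, hPM⟩ := P.exists_le_maximal hP.ne_top
  have hPM' : P < M := lt_of_le_of_ne hPM (by rintro rfl; exact hmax hM)
  have h1 : Ideal.span {π} < P :=
    lt_of_le_of_ne ((Ideal.span_singleton_le_iff_mem _).2 hπP) (Ne.symm hPπ)
  have h0 : (⊥ : Ideal R) < Ideal.span {π} :=
    bot_lt_iff_ne_bot.2 (by simpa using hπ.ne_zero)
  let s : LTSeries (PrimeSpectrum R) :=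
    { length := 3
      toFun := ![⟨⊥, Ideal.isPrime_bot⟩, ⟨Ideal.span {π}, (Ideal.span_singleton_prime hπ.ne_zero).2 hπ⟩,
        ⟨P, hP⟩, ⟨M, hM.isPrime⟩]
      step := by
        intro i
        fin_cases i
        · exact h0
        · exact h1
        · exact hPM' }
  have : ((3 : ℕ) : WithBot ℕ∞) ≤ ringKrullDim R := Order.LTSeries.length_le_krullDim s
  exact absurd (this.trans hR) (by decide)

theorem MvPolynomial.finite_zeroLocus_of_isMaximal {k K σ : Type*} [Field k] [Field K] [Algebra k K]
    [Finite σ] {M : Ideal (MvPolynomial σ k)} (hM : M.IsMaximal) : (zeroLocus K M).Finite := by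
  let := Ideal.Quotient.field M
  have : Module.Finite k (MvPolynomial σ k ⧸ M) := finite_of_finite_type_of_isJacobsonRing _ _
  let F : zeroLocus K M → ((MvPolynomial σ k ⧸ M) →ₐ[k] K) := fun x =>
    Ideal.Quotient.liftₐ M (aeval x.1) x.2
  have hF : Function.Injective F := by
    intro x y hxy
    ext i
    have : aeval x.1 (X i : MvPolynomial σ k) = aeval y.1 (X i : MvPolynomial σ k) :=
      DFunLike.congr_fun hxy (Ideal.Quotient.mk M (X i))
    simpa using this
  exact Set.finite_coe_iff.1 (Finite.of_injective F hF)

/-- The generator is the product of the generators of the principal minimal primes. Off its zeros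
only the finitely many points of maximal minimal primes can remain, so `hfin` and the
Nullstellensatz put it in J. -/
theorem MvPolynomial.isPrincipal_of_isRadical {k K : Type*} [Field k] [Field K] [Algebra k K]
    [IsAlgClosed K] {J : Ideal (MvPolynomial (Fin 2) k)} (hJ : J.IsRadical)
    (hfin : ∀ G : MvPolynomial (Fin 2) k, {z ∈ zeroLocus K J | aeval z G ≠ 0}.Finite →
      ∀ z ∈ zeroLocus K J, aeval z G = 0) : J.IsPrincipal := by
  classical
  by_cases hbot : J = ⊥
  · rw [hbot]; infer_instance
  have hdim : ringKrullDim (MvPolynomial (Fin 2) k) ≤ 2 := by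
    rw [MvPolynomial.ringKrullDim_of_isNoetherianRing]
    simp
  have hmfin := J.finite_minimalPrimes_of_isNoetherianRing
  let Q : Finset (Ideal (MvPolynomial (Fin 2) k)) :=
    hmfin.toFinset.filter fun P => P.IsPrincipal
  have hQ : ∀ P ∈ Q, ∃ π, Prime π ∧ P = Ideal.span {π} := by
    intro P hP
    obtain ⟨hPm, ⟨π, hπ⟩⟩ := Finset.mem_filter.1 hP
    rw [Set.Finite.mem_toFinset] at hPm
    have hP0 : P ≠ ⊥ := by
      rintro rfl
      exact hbot (le_bot_iff.1 hPm.1.2)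
    have hπ' : P = Ideal.span {π} := hπ
    have hne : π ≠ 0 := by rintro rfl; simp at hπ'; exact hP0 hπ'
    exact ⟨π, (Ideal.span_singleton_prime hne).1 (hπ' ▸ hPm.1.1), hπ'⟩
  choose! π hπ hspan using hQ
  set G := ∏ P ∈ Q, π P with hG
  have hGJ : G ∈ J := by
    rw [← hJ.radical, ← vanishingIdeal_zeroLocus_eq_radical (K := K), mem_vanishingIdeal_iff]
    apply hfin G
    have : (⋃ P ∈ {P ∈ J.minimalPrimes | P.IsMaximal}, zeroLocus K P).Finite :=
      (hmfin.subset fun _ h => h.1).biUnion fun P hP => finite_zeroLocus_of_isMaximal hP.2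
    refine this.subset ?_
    rintro z ⟨hz, hzG⟩
    have hker : (RingHom.ker (aeval z : MvPolynomial (Fin 2) k →ₐ[k] K)).IsPrime :=
      RingHom.ker_isPrime _
    obtain ⟨P, hP, hPz⟩ := Ideal.exists_minimalPrimes_le (I := J)
      (J := RingHom.ker (aeval z : MvPolynomial (Fin 2) k →ₐ[k] K)) hz
    rcases hP.1.1.isPrincipal_or_isMaximal hdim with h | h
    · exfalso
      have hPQ : P ∈ Q := Finset.mem_filter.2 ⟨hmfin.mem_toFinset.2 hP, h⟩
      apply hzG
      have : π P ∈ P :=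
        (hspan P hPQ).ge (Ideal.mem_span_singleton_self (π P))
      obtain ⟨c, hc⟩ := Finset.dvd_prod_of_mem π hPQ
      rw [hG, hc, map_mul, (show aeval z (π P) = 0 from hPz this), zero_mul]
    · exact Set.mem_biUnion (⟨hP, h⟩ : P ∈ {P ∈ J.minimalPrimes | P.IsMaximal}) hPz
  refine ⟨⟨G, le_antisymm ?_ ((Ideal.span_singleton_le_iff_mem _).2 hGJ)⟩⟩
  intro j hj
  refine Ideal.mem_span_singleton.2 (Finset.prod_dvd_of_isRelPrime ?_ ?_)
  · intro P hP P' hP' hne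
    refine (hπ P hP).irreducible.isRelPrime_iff_not_dvd.2 fun hdvd => hne ?_
    rw [hspan P hP, hspan P' hP', Ideal.span_singleton_eq_span_singleton]
    exact (hπ P hP).associated_of_dvd (hπ P' hP') hdvd
  · intro P hP
    rw [← Ideal.mem_span_singleton, ← hspan P hP]
    exact ((hmfin.mem_toFinset.1 (Finset.mem_filter.1 hP).1).1.2) hj

/-! ### Divisors of homogeneous polynomials -/

theorem MvPolynomial.IsHomogeneous.of_dvd {R σ : Type*} [CommRing R] [IsDomain R]
    {f g : MvPolynomial σ R} {n : ℕ} (hf : f.IsHomogeneous n) (hf0 : f ≠ 0) (hgf : g ∣ f) :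
    ∃ m, g.IsHomogeneous m := by
  obtain ⟨h, rfl⟩ := hgf
  -- `T` records the grading: the coefficient of X^k is the component of degree k. Lowest and
  -- highest degrees add under products, and they agree for g * h, so they agree for g.
  let T : MvPolynomial σ R →ₐ[R] Polynomial (MvPolynomial σ R) :=
    MvPolynomial.aeval fun i => Polynomial.C (X i) * Polynomial.X
  have hT : ∀ u : σ →₀ ℕ, ∀ a, T (monomial u a) = Polynomial.monomial u.degree (monomial u a) := by
    intro u a
    rw [aeval_monomial, monomial_eq (s := u), ← Polynomial.C_mul_X_pow_eq_monomial]
    simp only [mul_pow, Finsupp.prod, Finset.prod_mul_distrib, Finset.prod_pow_eq_pow_sum,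
      map_mul, map_prod, map_pow, Finsupp.degree_apply, mul_assoc]
    rfl
  have hcoeff : ∀ p : MvPolynomial σ R, ∀ k, (T p).coeff k = homogeneousComponent k p := by
    intro p k
    induction p using MvPolynomial.induction_on' with
    | monomial u a =>
      rw [hT, Polynomial.coeff_monomial]
      split_ifs with hk
      · exact (homogeneousComponent_eq_self (isHomogeneous_monomial a hk)).symm
      · rw [homogeneousComponent_of_mem
          ((mem_homogeneousSubmodule _ _).2 (isHomogeneous_monomial a (rfl : u.degree = u.degree))),
          if_neg (Ne.symm hk)]
    | add p q hp hq => simp [hp, hq]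
  have hT0 : ∀ p, p ≠ 0 → T p ≠ 0 := by
    intro p hp hTp
    apply hp
    rw [← sum_homogeneousComponent p]
    exact Finset.sum_eq_zero fun i _ => by rw [← hcoeff, hTp, Polynomial.coeff_zero]
  have hg0 := left_ne_zero_of_mul hf0
  have hh0 := right_ne_zero_of_mul hf0
  have hgh : T g * T h = Polynomial.monomial n (g * h) := by
    rw [← map_mul]
    ext1 k
    rw [hcoeff, Polynomial.coeff_monomial, homogeneousComponent_of_mem hf]
    simp [eq_comm]
  have h1 := Polynomial.natDegree_mul (hT0 g hg0) (hT0 h hh0)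
  have h2 := Polynomial.natTrailingDegree_mul (hT0 g hg0) (hT0 h hh0)
  rw [hgh, Polynomial.natDegree_monomial_eq _ hf0] at h1
  rw [hgh, Polynomial.natTrailingDegree_monomial hf0] at h2
  have h3 := (T g).natTrailingDegree_le_natDegree
  have h4 := (T h).natTrailingDegree_le_natDegree
  have h5 : (T g).natTrailingDegree = (T g).natDegree := by omega
  refine ⟨(T g).natDegree, ?_⟩
  have : homogeneousComponent (T g).natDegree g = g := by
    conv_rhs => rw [← sum_homogeneousComponent g]
    have h6 : ∀ i, i ≠ (T g).natDegree → homogeneousComponent i g = 0 := by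
      intro i hi
      rw [← hcoeff]
      rcases lt_or_gt_of_ne hi with h | h
      · exact Polynomial.coeff_eq_zero_of_lt_natTrailingDegree (h5 ▸ h)
      · exact Polynomial.coeff_eq_zero_of_natDegree_lt h
    rw [Finset.sum_eq_single (T g).natDegree (fun i _ hi => h6 i hi)]
    intro h
    exact homogeneousComponent_eq_zero _ _ (by simpa using h)
  have h7 := homogeneousComponent_isHomogeneous (T g).natDegree g
  rwa [this] at h7

noncomputable section

namespace Kippenhahn

/-! ### Plane curves over ℂ and their Gauss maps -/

theorem eval_smul_of_isHomogeneous {R σ : Type*} [CommRing R] {F : MvPolynomial σ R} {n : ℕ}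
    (hF : F.IsHomogeneous n) (c : R) (p : σ → R) : eval (c • p) F = c ^ n * eval p F := by
  rw [eval_eq, eval_eq, Finset.mul_sum]
  refine Finset.sum_congr rfl fun u hu => ?_
  simp only [Pi.smul_apply, smul_eq_mul, mul_pow, Finset.prod_mul_distrib,
    Finset.prod_pow_eq_pow_sum]
  rw [← Finsupp.degree_apply, hF.degree_eq_sum_deg_support hu, Finsupp.degree_apply]
  ring

theorem irreducible_of_isHomogeneous_one {k σ : Type*} [Field k] {p : MvPolynomial σ k}
    (hp : p.IsHomogeneous 1) (hp0 : p ≠ 0) : Irreducible p := by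
  refine irreducible_of_totalDegree_eq_one (hp.totalDegree hp0) fun x hx => ?_
  obtain ⟨u, hu⟩ := ne_zero_iff.1 hp0
  exact isUnit_of_dvd_unit (hx u) hu.isUnit

/-- The affine part of the projection to the dual plane of the projectivized conormal variety
of `F`. -/
def dualSet (F : MvPolynomial (Fin 3) ℂ) : Set (Fin 2 → ℂ) :=
  {z | ∃ p : Fin 3 → ℂ, p ≠ 0 ∧ eval p F = 0 ∧ p 0 + p 1 * z 0 + p 2 * z 1 = 0 ∧
    eval p (pderiv 1 F) = eval p (pderiv 0 F) * z 0 ∧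
    eval p (pderiv 2 F) = eval p (pderiv 0 F) * z 1}

theorem euler_eval {F : MvPolynomial (Fin 3) ℂ} {d : ℕ} (hF : F.IsHomogeneous d)
    (p : Fin 3 → ℂ) :
    p 0 * eval p (pderiv 0 F) + p 1 * eval p (pderiv 1 F) + p 2 * eval p (pderiv 2 F)
      = d * eval p F := by
  have := congrArg (eval p) hF.sum_X_mul_pderiv
  simpa [Fin.sum_univ_three] using this

/-- Restrict F to two affine charts of the line. Without a root in the first, the restriction is a
constant c; in the second it is then cτ^e, which vanishes at τ = 0. -/
theorem exists_zero_on_line {F : MvPolynomial (Fin 3) ℂ} {e : ℕ} (hF : F.IsHomogeneous e)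
    (he : e ≠ 0) (a b : ℂ) :
    ∃ p : Fin 3 → ℂ, p ≠ 0 ∧ p 0 + p 1 * a + p 2 * b = 0 ∧ eval p F = 0 := by
  by_contra! hne
  let q : Polynomial ℂ :=
    aeval ![-(Polynomial.C a * Polynomial.X + Polynomial.C b), Polynomial.X, 1] F
  have hq : ∀ τ, q.eval τ = eval ![-(a * τ + b), τ, 1] F := by
    intro τ
    rw [← Polynomial.coe_aeval_eq_eval, ← AlgHom.comp_apply, comp_aeval, aeval_eq_eval]
    congr 2
    ext i
    fin_cases i <;> simp
  have hdeg : q.degree = 0 := by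
    by_contra hdeg
    obtain ⟨τ, hτ⟩ := IsAlgClosed.exists_root q hdeg
    refine hne ![-(a * τ + b), τ, 1] (fun h => ?_) ?_ ((hq τ).symm.trans hτ)
    · simpa using congrFun h 2
    · simp; ring
  obtain ⟨c, hc⟩ : ∃ c, q = Polynomial.C c := ⟨_, Polynomial.eq_C_of_degree_eq_zero hdeg⟩
  let r : Polynomial ℂ :=
    aeval ![-(Polynomial.C a + Polynomial.C b * Polynomial.X), 1, Polynomial.X] F
  have hr : ∀ τ, r.eval τ = eval ![-(a + b * τ), 1, τ] F := by
    intro τ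
    rw [← Polynomial.coe_aeval_eq_eval, ← AlgHom.comp_apply, comp_aeval, aeval_eq_eval]
    congr 2
    ext i
    fin_cases i <;> simp
  -- The extra factor X makes the identity trivial at τ = 0, where the change of chart is undefined.
  have hX : Polynomial.X * r = Polynomial.X * (Polynomial.C c * Polynomial.X ^ e) := by
    apply Polynomial.funext
    intro τ
    simp only [Polynomial.eval_mul, Polynomial.eval_X, Polynomial.eval_C, Polynomial.eval_pow]
    by_cases hτ : τ = 0
    · simp [hτ]
    · have h1 : (![-(a + b * τ), 1, τ] : Fin 3 → ℂ) = τ • ![-(a * τ⁻¹ + b), τ⁻¹, 1] := by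
        ext i
        fin_cases i
        · simp; field_simp
        · simp [hτ]
        · simp
      rw [hr, h1, eval_smul_of_isHomogeneous hF, ← hq, hc, Polynomial.eval_C]
      ring
  have hr' := mul_left_cancel₀ Polynomial.X_ne_zero hX
  have h0 := hr 0
  rw [hr'] at h0
  simp [he] at h0
  refine hne _ (fun h => ?_) ?_ h0.symm
  · simpa using congrFun h 1
  · simp

/-- Clears denominators, so that G composed with the affine Gauss map can be tested for
divisibility. -/
theorem exists_numerator {σ : Type*} (u : MvPolynomial σ ℂ) (w : Fin 2 → MvPolynomial σ ℂ)
    (G : MvPolynomial (Fin 2) ℂ) :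
    ∃ (N : MvPolynomial σ ℂ) (e : ℕ), ∀ v, eval v u ≠ 0 →
      eval v N = eval v u ^ e * eval (fun i => eval v (w i) / eval v u) G := by
  induction G using MvPolynomial.induction_on with
  | C a => exact ⟨C a, 0, by simp⟩
  | add p q hp hq =>
    obtain ⟨N, e, h⟩ := hp
    obtain ⟨N', e', h'⟩ := hq
    refine ⟨u ^ e' * N + u ^ e * N', e + e', fun v hv => ?_⟩
    simp only [map_add, map_mul, map_pow, h v hv, h' v hv]
    ring
  | mul_X p i hp =>
    obtain ⟨N, e, h⟩ := hp
    refine ⟨N * w i, e + 1, fun v hv => ?_⟩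
    simp only [map_mul, h v hv, eval_X, pow_succ]
    field_simp

theorem dvd_of_forall_eval_eq_zero {σ : Type*} [Finite σ] {g q : MvPolynomial σ ℂ} (hg : Prime g)
    (h : ∀ v, eval v g = 0 → eval v q = 0) : g ∣ q := by
  have hP : (Ideal.span {g}).IsPrime := (Ideal.span_singleton_prime hg.ne_zero).2 hg
  rw [← Ideal.mem_span_singleton, ← IsPrime.vanishingIdeal_zeroLocus (K := ℂ) (Ideal.span {g}),
    mem_vanishingIdeal_iff]
  intro v hv
  rw [zeroLocus_span] at hv
  simpa using h v (by simpa using hv g rfl)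

theorem exists_prime_factor_eval_eq_zero {σ : Type*} {F : MvPolynomial σ ℂ} (hF : F ≠ 0)
    {p : σ → ℂ} (hp : eval p F = 0) : ∃ g, Prime g ∧ g ∣ F ∧ eval p g = 0 := by
  obtain ⟨s, hs, hsF⟩ := UniqueFactorizationMonoid.exists_prime_factors F hF
  have h : eval p s.prod = 0 := zero_dvd_iff.1 (hp ▸ map_dvd (eval p) hsF.symm.dvd)
  rw [← Multiset.prod_hom, Multiset.prod_eq_zero_iff, Multiset.mem_map] at h
  obtain ⟨g, hg, hg0⟩ := h
  exact ⟨g, hs g hg, (Multiset.dvd_prod hg).trans hsF.dvd, hg0⟩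

/-- If a polynomial function is nonzero at only finitely many points of the dual set, then a
point of the dual set outside of its zeros that comes from a regular point of the curve is
incident to a singular point of the curve: the curve contains a line. -/
theorem exists_singular_of_regular {F : MvPolynomial (Fin 3) ℂ} {d : ℕ} (hF : F.IsHomogeneous d)
    (hd : 2 ≤ d) {G : MvPolynomial (Fin 2) ℂ} (hG : {w ∈ dualSet F | eval w G ≠ 0}.Finite)
    {z : Fin 2 → ℂ} (hz : eval z G ≠ 0) {p : Fin 3 → ℂ} (hp : eval p F = 0)
    (h0 : eval p (pderiv 0 F) ≠ 0) (h1 : eval p (pderiv 1 F) = eval p (pderiv 0 F) * z 0)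
    (h2 : eval p (pderiv 2 F) = eval p (pderiv 0 F) * z 1) :
    ∃ p' : Fin 3 → ℂ, p' ≠ 0 ∧ p' 0 + p' 1 * z 0 + p' 2 * z 1 = 0 ∧ eval p' F = 0 ∧
      ∀ i, eval p' (pderiv i F) = 0 := by
  have hF0 : F ≠ 0 := by rintro rfl; simp at h0
  obtain ⟨g, hg, hgF, hgp⟩ := exists_prime_factor_eval_eq_zero hF0 hp
  have hgt : ¬ g ∣ pderiv 0 F := fun h => h0 (zero_dvd_iff.1 (hgp ▸ map_dvd (eval p) h))
  set W : Fin 2 → MvPolynomial (Fin 3) ℂ := ![pderiv 1 F, pderiv 2 F] with hW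
  obtain ⟨N, e, hN⟩ := exists_numerator (pderiv 0 F) W G
  have hquot : (fun i => eval p (W i) / eval p (pderiv 0 F)) = z := by
    ext i
    fin_cases i
    · simp [hW, h1, h0]
    · simp [hW, h2, h0]
  have hgN : ¬ g ∣ N := by
    intro h
    have : eval p N = 0 := zero_dvd_iff.1 (hgp ▸ map_dvd (eval p) h)
    rw [hN p h0, hquot] at this
    exact mul_ne_zero (pow_ne_zero _ h0) hz this
  -- The Gauss map is constant on V(g). If not, each exceptional value w has a coordinate difference
  -- prime to g. Yet the product of these differences with `pderiv 0 F * N` vanishes on V(g): where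
  -- the last two factors are nonzero, the Gauss image is itself exceptional.
  have key : ∃ w : Fin 2 → ℂ, ∀ i, g ∣ W i - C (w i) * pderiv 0 F := by
    by_contra! hkey
    choose i hi using hkey
    have hprod : ¬ g ∣ (∏ w ∈ hG.toFinset, (W (i w) - C (w (i w)) * pderiv 0 F)) *
        (pderiv 0 F * N) := by
      rw [hg.dvd_mul, hg.dvd_mul, hg.dvd_finsetProd_iff]
      rintro (⟨w, -, hw⟩ | h | h)
      · exact hi w hw
      · exact hgt h
      · exact hgN h
    apply hprod
    apply dvd_of_forall_eval_eq_zero hg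
    intro v hv
    by_contra hne
    simp only [map_mul, map_prod, mul_ne_zero_iff, Finset.prod_ne_zero_iff] at hne
    obtain ⟨hne1, hvt, hvN⟩ := hne
    rw [hN v hvt] at hvN
    set w : Fin 2 → ℂ := fun i => eval v (W i) / eval v (pderiv 0 F) with hw
    have hw0 : eval v (pderiv 1 F) = eval v (pderiv 0 F) * w 0 := by
      simp [hw, hW]; field_simp
    have hw1 : eval v (pderiv 2 F) = eval v (pderiv 0 F) * w 1 := by
      simp [hw, hW]; field_simp
    have hvF : eval v F = 0 := zero_dvd_iff.1 (hv ▸ map_dvd (eval v) hgF)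
    have hmem : w ∈ hG.toFinset := by
      rw [Set.Finite.mem_toFinset]
      refine ⟨⟨v, ?_, hvF, ?_, hw0, hw1⟩, right_ne_zero_of_mul hvN⟩
      · rintro rfl
        apply hvt
        have := eval_smul_of_isHomogeneous (hF.pderiv (i := 0)) 0 (0 : Fin 3 → ℂ)
        rw [zero_smul, zero_pow (by omega), zero_mul] at this
        exact this
      · have := euler_eval hF v
        rw [hw0, hw1, hvF] at this
        apply mul_left_cancel₀ hvt
        linear_combination this
    apply hne1 w hmem
    simp only [map_sub, map_mul, eval_C, hw]
    field_simp
    simp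
  obtain ⟨w, hw⟩ := key
  have hwz : w = z := by
    ext i
    have : eval p (W i - C (w i) * pderiv 0 F) = 0 :=
      zero_dvd_iff.1 (hgp ▸ map_dvd (eval p) (hw i))
    rw [map_sub, map_mul, eval_C, sub_eq_zero] at this
    rw [← hquot]
    exact (eq_div_iff h0).2 this.symm
  subst hwz
  -- With a constant Gauss map, Euler's relation makes this linear form times `pderiv 0 F` vanish on
  -- V(g).
  have hgl : g ∣ X 0 + C (w 0) * X 1 + C (w 1) * X 2 := by
    refine (hg.dvd_or_dvd (b := pderiv 0 F) ?_).resolve_right hgt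
    apply dvd_of_forall_eval_eq_zero hg
    intro v hv
    have hvF : eval v F = 0 := zero_dvd_iff.1 (hv ▸ map_dvd (eval v) hgF)
    have e0 : eval v (W 0 - C (w 0) * pderiv 0 F) = 0 :=
      zero_dvd_iff.1 (hv ▸ map_dvd (eval v) (hw 0))
    have e1 : eval v (W 1 - C (w 1) * pderiv 0 F) = 0 :=
      zero_dvd_iff.1 (hv ▸ map_dvd (eval v) (hw 1))
    have e2 := euler_eval hF v
    simp only [hW, map_sub, map_mul, eval_C, Matrix.cons_val_zero, Matrix.cons_val_one] at e0 e1
    simp only [map_add, map_mul, eval_C, eval_X]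
    rw [hvF] at e2
    linear_combination e2 - v 1 * e0 - v 2 * e1
  have hl : (X 0 + C (w 0) * X 1 + C (w 1) * X 2 : MvPolynomial (Fin 3) ℂ).IsHomogeneous 1 :=
    ((isHomogeneous_X _ _).add (isHomogeneous_C_mul_X _ _)).add (isHomogeneous_C_mul_X _ _)
  have hirr : Irreducible (X 0 + C (w 0) * X 1 + C (w 1) * X 2 : MvPolynomial (Fin 3) ℂ) := by
    refine irreducible_of_isHomogeneous_one hl fun h => ?_
    simpa using congrArg (eval ![1, 0, 0]) h
  have hlg : X 0 + C (w 0) * X 1 + C (w 1) * X 2 ∣ g := hg.irreducible.dvd_symm hirr hgl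
  -- The partial has degree d - 1 ≥ 1, so it has a zero on the line component; there the other
  -- partials, its multiples modulo g, vanish too.
  obtain ⟨p', hp', hl', ht'⟩ := exists_zero_on_line (hF.pderiv (i := 0)) (by omega) (w 0) (w 1)
  have hg' : eval p' g = 0 := by
    have := map_dvd (eval p') hlg
    simp only [map_add, map_mul, eval_C, eval_X] at this
    exact zero_dvd_iff.1 ((by linear_combination hl' :
      p' 0 + w 0 * p' 1 + w 1 * p' 2 = 0) ▸ this)
  have hd' : ∀ i, eval p' (W i) = 0 := by
    intro i
    have := zero_dvd_iff.1 (hg' ▸ map_dvd (eval p') (hw i))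
    simpa [ht'] using this
  refine ⟨p', hp', hl', zero_dvd_iff.1 (hg' ▸ map_dvd (eval p') hgF), fun i => ?_⟩
  fin_cases i
  · exact ht'
  · exact hd' 0
  · exact hd' 1

/-- If the dual set contains the dual line of `p`, then a polynomial function that is nonzero at
only finitely many points of the dual set vanishes on the line. -/
theorem eval_eq_zero_of_line {S : Set (Fin 2 → ℂ)} {G : MvPolynomial (Fin 2) ℂ}
    (hG : {w ∈ S | eval w G ≠ 0}.Finite) {p : Fin 3 → ℂ} (hp : p 1 ≠ 0 ∨ p 2 ≠ 0)
    (hS : ∀ w : Fin 2 → ℂ, p 0 + p 1 * w 0 + p 2 * w 1 = 0 → w ∈ S)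
    {z : Fin 2 → ℂ} (hz : p 0 + p 1 * z 0 + p 2 * z 1 = 0) : eval z G = 0 := by
  by_contra hne
  -- The dual line parametrised from z. Along it G is a one-variable polynomial, nonzero at τ = 0
  -- and so with finitely many roots, while ℂ is infinite.
  let c : ℂ → Fin 2 → ℂ := fun τ => ![z 0 - τ * p 2, z 1 + τ * p 1]
  have hc : Function.Injective c := by
    intro τ τ' h
    have h0 := congrFun h 0
    have h1 := congrFun h 1
    simp [c] at h0 h1
    rcases hp with hp | hp
    · exact h1.resolve_right hp
    · exact h0.resolve_right hp
  let q : Polynomial ℂ := aeval ![Polynomial.C (z 0) - Polynomial.X * Polynomial.C (p 2),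
    Polynomial.C (z 1) + Polynomial.X * Polynomial.C (p 1)] G
  have hq : ∀ τ, q.eval τ = eval (c τ) G := by
    intro τ
    rw [← Polynomial.coe_aeval_eq_eval, ← AlgHom.comp_apply, comp_aeval, aeval_eq_eval]
    congr 2
    ext i
    fin_cases i <;> simp [c] <;> ring
  have hq0 : q ≠ 0 := by
    intro h
    have := hq 0
    have hc0 : c 0 = z := by ext i; fin_cases i <;> simp [c]
    rw [h, hc0] at this
    exact hne (by simpa using this.symm)
  have hfin : {τ | q.eval τ ≠ 0}.Finite := by
    refine Set.Finite.of_finite_image (hG.subset ?_) hc.injOn (f := c)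
    rintro _ ⟨τ, hτ, rfl⟩
    refine ⟨hS _ ?_, hq τ ▸ hτ⟩
    simp only [c, Matrix.cons_val_zero, Matrix.cons_val_one]
    linear_combination hz
  have hroots : {τ | q.eval τ = 0}.Finite := by
    refine q.roots.toFinset.finite_toSet.subset fun τ hτ => ?_
    simpa [hq0] using hτ
  refine (Set.infinite_univ (α := ℂ)) ((hfin.union hroots).subset fun τ _ => ?_)
  by_cases h : q.eval τ = 0
  · exact Or.inr h
  · exact Or.inl h

/-! ### The incidence ideal and its elimination -/

theorem aeval_eq_eval_map {σ : Type*} (f : MvPolynomial σ ℝ) (p : σ → ℂ) :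
    aeval p f = eval p (map (algebraMap ℝ ℂ) f) := by
  rw [aeval_def, eval₂_eq_eval_map]

theorem grad_eq (f : MvPolynomial (Fin 3) ℝ) (p : Fin 3 → ℂ) (i : Fin 3) :
    grad f p i = eval p (pderiv i (map (algebraMap ℝ ℂ) f)) := by
  rw [grad, aeval_eq_eval_map, pderiv_map]

/-- The generators of the incidence ideal as polynomials in `t, x, y` over `ℝ[a, b]`. -/
def incidenceGenerators (f : MvPolynomial (Fin 3) ℝ) :
    Fin 2 ⊕ Fin 3 × Fin 3 → MvPolynomial (Fin 3) (MvPolynomial (Fin 2) ℝ) :=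
  let v : Fin 3 → MvPolynomial (Fin 2) ℝ := ![1, X 0, X 1]
  Sum.elim ![map C f, X 0 + C (X 0) * X 1 + C (X 1) * X 2]
    fun ij => C (v ij.1) * map C (pderiv ij.2 f) - C (v ij.2) * map C (pderiv ij.1 f)

theorem isHomogeneous_incidenceGenerators {f : MvPolynomial (Fin 3) ℝ} {d : ℕ}
    (hf : f.IsHomogeneous d) (i : Fin 2 ⊕ Fin 3 × Fin 3) :
    (incidenceGenerators f i).IsHomogeneous (Sum.elim ![d, 1] (fun _ => d - 1) i) := by
  rcases i with i | ij
  · fin_cases i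
    · exact hf.map C
    · exact ((isHomogeneous_X _ _).add (isHomogeneous_C_mul_X _ _)).add
        (isHomogeneous_C_mul_X _ _)
  · exact ((hf.pderiv.map C).C_mul _).sub ((hf.pderiv.map C).C_mul _)

theorem sumAlgEquiv_symm_map_C (f : MvPolynomial (Fin 3) ℝ) :
    (sumAlgEquiv ℝ (Fin 3) (Fin 2)).symm (map C f) = rename Sum.inl f := by
  rw [AlgEquiv.symm_apply_eq]
  exact (DFunLike.congr_fun (sumAlgEquiv_comp_rename_inl (R := ℝ) (S₁ := Fin 3) (S₂ := Fin 2)) f).symm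

theorem sumAlgEquiv_rename_inr (h : MvPolynomial (Fin 2) ℝ) :
    sumAlgEquiv ℝ (Fin 3) (Fin 2) (rename Sum.inr h) = C h :=
  DFunLike.congr_fun (sumAlgEquiv_comp_rename_inr (R := ℝ) (S₁ := Fin 3) (S₂ := Fin 2)) h

theorem sumAlgEquiv_symm_incidenceGenerators_mem (f : MvPolynomial (Fin 3) ℝ)
    (i : Fin 2 ⊕ Fin 3 × Fin 3) :
    (sumAlgEquiv ℝ (Fin 3) (Fin 2)).symm (incidenceGenerators f i) ∈ incidenceIdeal f := by
  have hv : ∀ i : Fin 3, (sumAlgEquiv ℝ (Fin 3) (Fin 2)).symm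
      (C ((![1, X 0, X 1] : Fin 3 → MvPolynomial (Fin 2) ℝ) i)) = polarMatrix f 0 i := by
    intro i
    fin_cases i
    · simp [polarMatrix]
    · exact sumAlgEquiv_symm_C_X _ _ _ 0
    · exact sumAlgEquiv_symm_C_X _ _ _ 1
  rcases i with i | ⟨i, j⟩
  · apply Ideal.mem_sup_left
    apply Ideal.subset_span
    fin_cases i
    · exact Or.inl (sumAlgEquiv_symm_map_C f)
    · right
      simp [incidenceGenerators, sumAlgEquiv_symm_X, sumAlgEquiv_symm_C_X]
  · apply Ideal.mem_sup_right
    apply Ideal.subset_span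
    refine ⟨(i, j), ?_⟩
    simp only [incidenceGenerators, Sum.elim_inr, map_sub, map_mul, hv, sumAlgEquiv_symm_map_C,
      Matrix.det_fin_two, Matrix.submatrix_apply]
    simp [polarMatrix]

theorem incidenceIdeal_le_ker {f : MvPolynomial (Fin 3) ℝ} {p : Fin 3 → ℂ} {z : Fin 2 → ℂ}
    (hp : eval p (map (algebraMap ℝ ℂ) f) = 0) (hl : p 0 + p 1 * z 0 + p 2 * z 1 = 0)
    (h1 : eval p (pderiv 1 (map (algebraMap ℝ ℂ) f)) =
      eval p (pderiv 0 (map (algebraMap ℝ ℂ) f)) * z 0)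
    (h2 : eval p (pderiv 2 (map (algebraMap ℝ ℂ) f)) =
      eval p (pderiv 0 (map (algebraMap ℝ ℂ) f)) * z 1) :
    incidenceIdeal f ≤ RingHom.ker (aeval (Sum.elim p z) : R5 →ₐ[ℝ] ℂ) := by
  have hren : ∀ q : MvPolynomial (Fin 3) ℝ, aeval (Sum.elim p z) (rename Sum.inl q : R5) =
      eval p (map (algebraMap ℝ ℂ) q) := by
    intro q
    rw [aeval_rename, Sum.elim_comp_inl, aeval_eq_eval_map]
  refine sup_le (Ideal.span_le.2 ?_) (Ideal.span_le.2 ?_)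
  · rintro _ (rfl | rfl)
    · exact (hren f).trans hp
    · change aeval (Sum.elim p z) _ = (0 : ℂ)
      simp only [map_add, map_mul, aeval_X, Sum.elim_inl, Sum.elim_inr]
      linear_combination hl
  · rintro _ ⟨⟨i, j⟩, rfl⟩
    have hv : ∀ i, aeval (Sum.elim p z) (polarMatrix f 0 i) = (![1, z 0, z 1] : Fin 3 → ℂ) i := by
      intro i
      fin_cases i <;> simp [polarMatrix]
    have hg : ∀ i, aeval (Sum.elim p z) (polarMatrix f 1 i) =
        eval p (pderiv 0 (map (algebraMap ℝ ℂ) f)) * (![1, z 0, z 1] : Fin 3 → ℂ) i := by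
      intro i
      change aeval (Sum.elim p z) (rename Sum.inl (pderiv i f) : R5) = _
      rw [hren, ← pderiv_map]
      fin_cases i
      · simp
      · exact h1
      · exact h2
    change aeval (Sum.elim p z) ((polarMatrix f).submatrix id ![i, j]).det = (0 : ℂ)
    rw [Matrix.det_fin_two]
    simp only [Matrix.submatrix_apply, map_sub, map_mul, id, hv, hg]
    ring

theorem saturate_le_of_le {R : Type*} [CommRing R] {I K P : Ideal R} (hP : P.IsPrime)
    (hI : I ≤ P) (hK : ¬ K ≤ P) : saturate I K ≤ P := by
  refine iSup_le fun n r hr => ?_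
  obtain ⟨x, hx, hxP⟩ := SetLike.not_le_iff_exists.1 hK
  have := Submodule.mem_colon.1 hr (x ^ n) (Ideal.pow_mem_pow hx n)
  exact (hP.mem_or_mem (hI this)).resolve_right fun h => hxP (hP.mem_of_pow_mem n h)

/-- If no p lies over z, elimination gives h with h(z) ≠ 0 and h·⟨t,x,y⟩^m inside the incidence
ideal. Conversely, for p over z the prime kernel of evaluation at (p,z) contains the incidence ideal
but not ⟨t,x,y⟩, hence contains the saturation. -/
theorem zeroLocus_radical_eliminate {f : MvPolynomial (Fin 3) ℝ} {d : ℕ}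
    (hf : f.IsHomogeneous d) :
    zeroLocus ℂ (eliminate (saturate (incidenceIdeal f) irrelevantIdeal)).radical =
      dualSet (map (algebraMap ℝ ℂ) f) := by
  ext z
  constructor
  · intro hz
    by_contra hne
    obtain ⟨h, m, hh, hm⟩ := exists_C_mul_monomial_mem_span
      (aeval z : MvPolynomial (Fin 2) ℝ →ₐ[ℝ] ℂ).toRingHom (incidenceGenerators f) _
      (isHomogeneous_incidenceGenerators hf) (fun p hp => by
        by_contra hp0
        have hcomp : (aeval z : MvPolynomial (Fin 2) ℝ →ₐ[ℝ] ℂ).toRingHom.comp C =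
            algebraMap ℝ ℂ := by
          ext; simp
        have hmap : ∀ q : MvPolynomial (Fin 3) ℝ,
            eval₂ (aeval z : MvPolynomial (Fin 2) ℝ →ₐ[ℝ] ℂ).toRingHom p (map C q) =
              eval p (map (algebraMap ℝ ℂ) q) := by
          intro q
          rw [eval₂_map, hcomp, eval₂_eq_eval_map]
        refine hne ⟨p, hp0, ?_, ?_, ?_, ?_⟩
        · exact (hmap f).symm.trans (hp (Sum.inl 0))
        · have := hp (Sum.inl 1)
          simp [incidenceGenerators] at this
          linear_combination this
        · have := hp (Sum.inr (0, 1))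
          simp only [incidenceGenerators, Sum.elim_inr, eval₂_sub, eval₂_mul, hmap] at this
          simp [← pderiv_map] at this
          linear_combination this
        · have := hp (Sum.inr (0, 2))
          simp only [incidenceGenerators, Sum.elim_inr, eval₂_sub, eval₂_mul, hmap] at this
          simp [← pderiv_map] at this
          linear_combination this)
    apply hh
    refine hz h (Ideal.le_radical ?_)
    change rename Sum.inr h ∈ saturate _ _
    refine (le_iSup (fun n : ℕ => Submodule.colon (incidenceIdeal f)
      ((irrelevantIdeal ^ n : Ideal R5) : Set R5)) m) (Submodule.mem_colon.2 fun x hx => ?_)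
    have hle : Ideal.span (Set.range (incidenceGenerators f)) ≤
        (incidenceIdeal f).comap (sumAlgEquiv ℝ (Fin 3) (Fin 2)).symm := by
      rw [Ideal.span_le]
      rintro _ ⟨i, rfl⟩
      exact sumAlgEquiv_symm_incidenceGenerators_mem f i
    have hx' : sumAlgEquiv ℝ (Fin 3) (Fin 2) x ∈ idealOfVars (Fin 3) (MvPolynomial (Fin 2) ℝ) ^ m := by
      have := Ideal.mem_map_of_mem (sumAlgEquiv ℝ (Fin 3) (Fin 2)) hx
      rw [Ideal.map_pow, irrelevantIdeal, Ideal.map_span, ← Set.range_comp] at this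
      convert! this
      ext i
      simp [sumAlgEquiv_X_inl]
    have hmem : ∀ y ∈ idealOfVars (Fin 3) (MvPolynomial (Fin 2) ℝ) ^ m,
        C h * y ∈ Ideal.span (Set.range (incidenceGenerators f)) := by
      intro y hy
      rw [pow_idealOfVars_eq_span] at hy
      induction hy using Submodule.span_induction with
      | mem y hy => obtain ⟨s, hs, rfl⟩ := hy; exact hm s hs
      | zero => simp
      | add x y _ _ hx hy => rw [mul_add]; exact add_mem hx hy
      | smul a x _ hx => rw [smul_eq_mul, mul_left_comm]; exact Ideal.mul_mem_left _ _ hx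
    have := hle (hmem _ hx')
    rw [← sumAlgEquiv_rename_inr, ← map_mul] at this
    simpa using this
  · rintro ⟨p, hp0, hp, hl, h1, h2⟩
    have hker : (RingHom.ker (aeval (Sum.elim p z) : R5 →ₐ[ℝ] ℂ)).IsPrime := RingHom.ker_isPrime _
    have hsat := saturate_le_of_le (K := irrelevantIdeal) hker
      (incidenceIdeal_le_ker hp hl h1 h2) (fun hle => hp0 (by
        ext i
        have : aeval (Sum.elim p z) (X (Sum.inl i) : R5) = (0 : ℂ) :=
          hle (Ideal.subset_span ⟨i, rfl⟩)
        simpa using this))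
    rintro h ⟨k, hk⟩
    have : aeval (Sum.elim p z) (rename Sum.inr (h ^ k) : R5) = (0 : ℂ) := hsat hk
    rw [aeval_rename, Sum.elim_comp_inr, map_pow] at this
    exact eq_zero_of_pow_eq_zero this

/-! ### The Kippenhahn polynomial and its square-free part -/

theorem isHomogeneous_kippenhahnPoly {n : ℕ} (A : Matrix (Fin n) (Fin n) ℂ) :
    (kippenhahnPoly A).IsHomogeneous n := by
  refine IsHomogeneous.of_map (f := algebraMap ℝ ℂ) (algebraMap ℝ ℂ).injective ?_
  rw [map_kippenhahnPoly, Matrix.det_apply]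
  refine IsHomogeneous.sum _ _ _ fun σ _ => ?_
  have hentry : ∀ i j, (pencil A i j).IsHomogeneous 1 := by
    intro i j
    simp only [pencil, Matrix.add_apply, Matrix.smul_apply, smul_eq_mul, Matrix.map_apply]
    refine (IsHomogeneous.add ?_ ?_).add ?_
    · rw [Matrix.one_apply]
      split_ifs
      · simpa using isHomogeneous_X ℂ (0 : Fin 3)
      · simpa using isHomogeneous_zero (Fin 3) ℂ 1
    · simpa [mul_comm] using isHomogeneous_C_mul_X (rePart A i j) (1 : Fin 3)
    · simpa [mul_comm] using isHomogeneous_C_mul_X (imPart A i j) (2 : Fin 3)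
  have hprod := IsHomogeneous.prod Finset.univ (fun i => pencil A (σ i) i) (fun _ => 1)
    fun i _ => hentry _ _
  simp only [Finset.sum_const, Finset.card_univ, Fintype.card_fin, smul_eq_mul, mul_one] at hprod
  rcases Int.units_eq_one_or (Equiv.Perm.sign σ) with h | h
  · simpa [h] using hprod
  · simpa [h] using hprod.neg

theorem eval_kippenhahnPoly_one_zero_zero {n : ℕ} (A : Matrix (Fin n) (Fin n) ℂ) :
    eval ![1, 0, 0] (kippenhahnPoly A) = 1 := by
  have h : eval ![1, 0, 0] (map (algebraMap ℝ ℂ) (kippenhahnPoly A)) = 1 := by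
    rw [map_kippenhahnPoly, RingHom.map_det, ← Matrix.det_one (n := Fin n) (R := ℂ)]
    congr 1
    ext i j
    simp [pencil, Matrix.one_apply, apply_ite (eval (![1, 0, 0] : Fin 3 → ℂ))]
  have h' : (![1, 0, 0] : Fin 3 → ℂ) = algebraMap ℝ ℂ ∘ ![1, 0, 0] := by
    ext i
    fin_cases i <;> simp
  rw [h', ← map_eval] at h
  exact (algebraMap ℝ ℂ).injective (h.trans (map_one _).symm)

theorem red_dvd (f : MvPolynomial (Fin 3) ℝ) : red f ∣ f :=
  letI : StrongNormalizationMonoid (MvPolynomial (Fin 3) ℝ) :=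
    UniqueFactorizationMonoid.strongNormalizationMonoid
  UniqueFactorizationMonoid.radical_dvd_self

theorem exists_dvd_red_pow {f : MvPolynomial (Fin 3) ℝ} (hf : f ≠ 0) : ∃ k, f ∣ red f ^ k :=
  letI : StrongNormalizationMonoid (MvPolynomial (Fin 3) ℝ) :=
    UniqueFactorizationMonoid.strongNormalizationMonoid
  UniqueFactorizationMonoid.exists_dvd_radical_self_pow hf

theorem isPowerOfLinearForm_of_associated {f r : MvPolynomial (Fin 3) ℝ}
    (hf : eval ![1, 0, 0] f = 1) (hr : r.IsHomogeneous 1) {i : ℕ} (h : Associated f (r ^ i)) :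
    IsPowerOfLinearForm f := by
  obtain ⟨u, hu⟩ := h.symm
  obtain ⟨c, -, hc⟩ := isUnit_iff_eq_C_of_isReduced.1 u.isUnit
  rw [hc] at hu
  set e := eval ![1, 0, 0] r
  have he : e ^ i * c = 1 := by
    rw [← hf, ← hu]
    simp [e]
  -- The value 1 at (1,0,0) forces the unit to be e^(-i), so it is absorbed into the linear form
  -- without extracting a root.
  refine ⟨C e⁻¹ * r, i, hr.C_mul _, ?_⟩
  rw [← hu, mul_pow, ← C_pow, inv_pow, mul_comm, eq_inv_of_mul_eq_one_right he]

theorem two_le_of_not_isPowerOfLinearForm {f : MvPolynomial (Fin 3) ℝ}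
    (hf : eval ![1, 0, 0] f = 1) (h : ¬ IsPowerOfLinearForm f) {d : ℕ}
    (hd : (red f).IsHomogeneous d) : 2 ≤ d := by
  have hf0 : f ≠ 0 := by rintro rfl; simp at hf
  have hr0 : red f ≠ 0 := ne_zero_of_dvd_ne_zero hf0 (red_dvd f)
  obtain ⟨k, hk⟩ := exists_dvd_red_pow hf0
  by_contra! hlt
  apply h
  interval_cases d
  · have hu : IsUnit (red f) := isUnit_iff_totalDegree_of_isReduced.2 (by
      have := (totalDegree_zero_iff_isHomogeneous _).2 hd
      have h2 := totalDegree_eq_zero_iff_eq_C.1 this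
      refine ⟨?_, this⟩
      rw [isUnit_iff_ne_zero]
      intro h0
      rw [h0, C_0] at h2
      exact hr0 h2)
    -- With exponent 0 any linear form serves, even zero.
    refine isPowerOfLinearForm_of_associated (r := 0) (i := 0) hf (isHomogeneous_zero _ _ _) ?_
    rw [pow_zero]
    exact associated_one_iff_isUnit.2 (isUnit_of_dvd_unit hk (hu.pow k))
  · obtain ⟨i, -, hi⟩ := (dvd_prime_pow (irreducible_of_isHomogeneous_one hd hr0).prime k).1 hk
    exact isPowerOfLinearForm_of_associated hf hd hi

theorem aeval_red_eq_zero_iff {f : MvPolynomial (Fin 3) ℝ} (hf : f ≠ 0) (p : Fin 3 → ℂ) :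
    aeval p (red f) = 0 ↔ aeval p f = 0 := by
  constructor
  · intro h
    obtain ⟨c, hc⟩ := red_dvd f
    rw [hc, map_mul, h, zero_mul]
  · intro h
    obtain ⟨k, hk⟩ := exists_dvd_red_pow hf
    have := map_dvd (aeval p : MvPolynomial (Fin 3) ℝ →ₐ[ℝ] ℂ) hk
    rw [h, map_pow, zero_dvd_iff] at this
    exact eq_zero_of_pow_eq_zero this

/-! ### Dual curve, dual lines and the conclusion -/

/-- The gradient is a multiple of (1,a,b), so it vanishes exactly when its first entry does; this
separates singular from regular p. Incidence with the line is automatic at regular points, by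
Euler's relation. -/
theorem dualVariety_union_dualLines {f : MvPolynomial (Fin 3) ℝ} (hf : f ≠ 0) {d : ℕ}
    (hd : (red f).IsHomogeneous d) :
    {z | affinePoint z ∈ dualVariety f} ∪ ⋃ p ∈ Sing f, dualLine p =
      dualSet (map (algebraMap ℝ ℂ) (red f)) := by
  have hd' := hd.map (algebraMap ℝ ℂ)
  have hV : ∀ P : P2, P ∈ projVariety f ↔ eval P.rep (map (algebraMap ℝ ℂ) (red f)) = 0 := by
    intro P
    rw [← aeval_eq_eval_map, aeval_red_eq_zero_iff hf]
    rfl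
  ext z
  constructor
  · rintro (⟨P, ⟨hP, -⟩, hgrad, hz⟩ | hz)
    · rw [affinePoint, Projectivization.mk_eq_mk_iff'] at hz
      obtain ⟨a, ha⟩ := hz
      have h0 : a * grad (red f) P.rep 0 = 1 := congrFun ha 0
      have h1 : a * grad (red f) P.rep 1 = z 0 := congrFun ha 1
      have h2 : a * grad (red f) P.rep 2 = z 1 := congrFun ha 2
      rw [grad_eq] at h0 h1 h2
      have hE := euler_eval hd' P.rep
      rw [(hV P).1 hP] at hE
      refine ⟨P.rep, P.rep_nonzero, (hV P).1 hP, ?_, ?_, ?_⟩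
      · linear_combination a * hE - P.rep 0 * h0 - P.rep 1 * h1 - P.rep 2 * h2
      · rw [← h1]
        linear_combination (-eval P.rep (pderiv 1 (map (algebraMap ℝ ℂ) (red f)))) * h0
      · rw [← h2]
        linear_combination (-eval P.rep (pderiv 2 (map (algebraMap ℝ ℂ) (red f)))) * h0
    · simp only [Set.mem_iUnion] at hz
      obtain ⟨P, ⟨hP, hgrad⟩, hz⟩ := hz
      have h : ∀ i, eval P.rep (pderiv i (map (algebraMap ℝ ℂ) (red f))) = 0 := fun i => by
        rw [← grad_eq, hgrad, Pi.zero_apply]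
      exact ⟨P.rep, P.rep_nonzero, (hV P).1 hP, hz, by simp [h], by simp [h]⟩
  · rintro ⟨p, hp0, hp, hl, h1, h2⟩
    obtain ⟨c, hc⟩ := Projectivization.exists_smul_eq_mk_rep ℂ p hp0
    set P : P2 := Projectivization.mk ℂ p hp0
    have hc' : P.rep = (c : ℂ) • p := hc.symm
    have hPV : P ∈ projVariety f := by
      rw [hV, hc', eval_smul_of_isHomogeneous hd', hp, mul_zero]
    have hg : ∀ i, grad (red f) P.rep i =
        (c : ℂ) ^ (d - 1) * eval p (pderiv i (map (algebraMap ℝ ℂ) (red f))) := fun i => by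
      rw [grad_eq, hc', eval_smul_of_isHomogeneous hd'.pderiv]
    by_cases h0 : eval p (pderiv 0 (map (algebraMap ℝ ℂ) (red f))) = 0
    · right
      simp only [Set.mem_iUnion]
      refine ⟨P, ⟨hPV, ?_⟩, ?_⟩
      · ext i
        rw [hg]
        fin_cases i <;> simp [h0, h1, h2]
      · change P.rep 0 + P.rep 1 * z 0 + P.rep 2 * z 1 = 0
        rw [hc']
        simp only [Pi.smul_apply, smul_eq_mul]
        linear_combination (c : ℂ) * hl
    · left
      have hg0 : grad (red f) P.rep 0 ≠ 0 := by
        rw [hg]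
        exact mul_ne_zero (pow_ne_zero _ c.ne_zero) h0
      have hne : grad (red f) P.rep ≠ 0 := fun h => hg0 (congrFun h 0)
      refine ⟨P, ⟨hPV, fun hS => hne hS.2⟩, hne, ?_⟩
      rw [affinePoint, Projectivization.mk_eq_mk_iff']
      refine ⟨(grad (red f) P.rep 0)⁻¹, ?_⟩
      have e1 : grad (red f) P.rep 1 = grad (red f) P.rep 0 * z 0 := by
        rw [hg, hg, h1, mul_assoc]
      have e2 : grad (red f) P.rep 2 = grad (red f) P.rep 0 * z 1 := by
        rw [hg, hg, h2, mul_assoc]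
      ext i
      fin_cases i
      · simp [hg0]
      · simp [e1, hg0]
      · simp [e2, hg0]

theorem eval_eq_zero_of_finite {F : MvPolynomial (Fin 3) ℂ} {d : ℕ} (hF : F.IsHomogeneous d)
    (hd : 2 ≤ d) (hF1 : eval ![1, 0, 0] F ≠ 0) {G : MvPolynomial (Fin 2) ℂ}
    (hG : {w ∈ dualSet F | eval w G ≠ 0}.Finite) {z : Fin 2 → ℂ} (hz : z ∈ dualSet F) :
    eval z G = 0 := by
  have hsing : ∀ p : Fin 3 → ℂ, p ≠ 0 → p 0 + p 1 * z 0 + p 2 * z 1 = 0 → eval p F = 0 →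
      (∀ i, eval p (pderiv i F) = 0) → eval z G = 0 := by
    intro p hp0 hl hp hgrad
    refine eval_eq_zero_of_line hG (p := p) ?_
      (fun w hw => ⟨p, hp0, hp, hw, by simp [hgrad], by simp [hgrad]⟩) hl
    -- Otherwise p is a multiple of (1,0,0), which is not on the curve; so the dual line of p is a
    -- genuine affine line.
    by_contra! hp12
    have hpe : p = p 0 • ![1, 0, 0] := by
      ext i
      fin_cases i <;> simp [hp12]
    have h0 : p 0 ≠ 0 := by
      intro h
      rw [h, zero_smul] at hpe
      exact hp0 hpe
    rw [hpe, eval_smul_of_isHomogeneous hF] at hp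
    exact mul_ne_zero (pow_ne_zero _ h0) hF1 hp
  obtain ⟨p, hp0, hp, hl, h1, h2⟩ := hz
  by_cases h0 : eval p (pderiv 0 F) = 0
  · refine hsing p hp0 hl hp fun i => ?_
    fin_cases i
    · exact h0
    · simpa [h0] using h1
    · simpa [h0] using h2
  · by_contra hne
    obtain ⟨p', hp', hl', hpF, hgrad⟩ := exists_singular_of_regular hF hd hG hne hp h0 h1 h2
    exact hne (hsing p' hp' hl' hpF hgrad)

end Kippenhahn

end

theorem mainTheorem5 {n : ℕ} (A : Matrix (Fin n) (Fin n) ℂ)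
    (hA : ¬ Kippenhahn.IsPowerOfLinearForm (Kippenhahn.kippenhahnPoly A)) :
    (Kippenhahn.idealJ A).IsPrincipal ∧
      MvPolynomial.zeroLocus ℂ (Kippenhahn.idealJ A) =
        {z | Kippenhahn.affinePoint z ∈ Kippenhahn.dualVariety (Kippenhahn.kippenhahnPoly A)} ∪
          ⋃ p ∈ Kippenhahn.Sing (Kippenhahn.kippenhahnPoly A), Kippenhahn.dualLine p := by
  have hf1 := Kippenhahn.eval_kippenhahnPoly_one_zero_zero A
  set f := Kippenhahn.kippenhahnPoly A with hf
  have hf0 : f ≠ 0 := by intro h; simp [h] at hf1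
  obtain ⟨d, hd⟩ := (Kippenhahn.isHomogeneous_kippenhahnPoly A).of_dvd hf0 (Kippenhahn.red_dvd f)
  have hd2 := Kippenhahn.two_le_of_not_isPowerOfLinearForm hf1 hA hd
  have hz : zeroLocus ℂ (Kippenhahn.idealJ A) =
      Kippenhahn.dualSet (map (algebraMap ℝ ℂ) (Kippenhahn.red f)) :=
    Kippenhahn.zeroLocus_radical_eliminate hd
  refine ⟨?_, hz.trans (Kippenhahn.dualVariety_union_dualLines hf0 hd).symm⟩
  -- The value of the square-free part at (1,0,0) divides that of f, which is det I = 1.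
  have hr1 : eval ![1, 0, 0] (map (algebraMap ℝ ℂ) (Kippenhahn.red f)) ≠ 0 := by
    have h' : (![1, 0, 0] : Fin 3 → ℂ) = algebraMap ℝ ℂ ∘ ![1, 0, 0] := by
      ext i
      fin_cases i <;> simp
    rw [h', ← map_eval]
    have := map_dvd (eval ![1, 0, 0]) (Kippenhahn.red_dvd f)
    rw [hf1] at this
    exact (map_ne_zero _).2 (ne_zero_of_dvd_ne_zero one_ne_zero this)
  refine isPrincipal_of_isRadical (K := ℂ) (Ideal.radical_isRadical _) fun G hG z hzJ => ?_
  change {w ∈ zeroLocus ℂ (Kippenhahn.idealJ A) | aeval w G ≠ 0}.Finite at hG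
  change z ∈ zeroLocus ℂ (Kippenhahn.idealJ A) at hzJ
  rw [hz] at hG hzJ
  simp only [Kippenhahn.aeval_eq_eval_map] at hG ⊢
  exact Kippenhahn.eval_eq_zero_of_finite (hd.map _) hd2 hr1 hG hzJ
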